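/- The bi-type binary Galton--Watson tree is the random rooted tree in which every vertex has one of two colours, blue ($b$) or red ($r$), the colour of the root has some given law, and the vertices, independently of each other, have children as follows: a blue vertex has no child with probability $p_0$, two blue children with probability $p_{bb}$, two red children with probability $p_{rr}$, and one blue and one red child with probability $p_{br}$, where $p_0+p_{bb}+p_{rr}+p_{br}=1$; a red vertex has these four sets of children with probabilities $q_0,q_{bb},q_{rr},q_{br}$, where $q_0+q_{bb}+q_{rr}+q_{br}=1$. Two players alternately move a token, which starts at the root, from its current vertex to a child of that vertex. Player P1 (called Stopper in the escape game) may only move from a vertex to a child of the same colour, and player P2 (Escaper) only to a child of the other colour. In the normal game the player who first fails to make a move loses; in the misère game the player who first fails to make a move wins; a play in which nobody ever fails to move is a draw. In the escape game Stopper wins if either player fails to make a move at some time, and Escaper wins otherwise. A player wins a game on a given tree if she has a strategy that wins against every strategy of her opponent; a player loses if her opponent wins; the normal or misère game results in a draw if neither player wins. For $i\in\{1,2\}$ and a colour $j\in\{b,r\}$ that the root has with positive probability, let $\mathrm{nd}_{i,j}$ (respectively $\mathrm{md}_{i,j}$) be the probability, conditioned on the root having colour $j$, that the normal (respectively misère)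 game in which P$i$ plays the first round results in a draw, and let $\mathrm{esl}_j$ be the probability, conditioned on the root having colour $j$, that Stopper loses the escape game in which she plays the first round. If $p_{br}=q_{br}=1$, then $\mathrm{nd}_{i,j}=\mathrm{md}_{i,j}=\mathrm{esl}_j=1$ for all such $i$ and $j$. Otherwise, $\mathrm{nd}_{i,j}=\mathrm{md}_{i,j}=\mathrm{esl}_j=0$ for all such $i$ and $j$. -/

import Mathlib

open MeasureTheory

namespace GWGame

/-! ### Rooted coloured trees -/

/-- Addresses of vertices. The root is `[]`; the address `(k, i) :: u` stands for the `i`-th child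
of colour `k` of the vertex with address `u`, where `i = 0, 1, 2, …`. -/
abbrev Vertex (C : Type) := List (C × ℕ)

/-- A rooted tree with vertices coloured by `C`: the colour of the root, together with the number
`T.2 u k` of children of colour `k` of the vertex `u`, for each `u` and `k`. (The numbers attached
to addresses that are not reached from the root play no role.) -/
abbrev ColouredTree (C : Type) := C × (Vertex C → C → ℕ)

/-- The colour of the vertex with a given address, in a tree whose root has colour `j`. -/
def colour {C : Type} (j : C) : Vertex C → C
  | [] => j
  | (k, _) :: _ => k

/-- `(u, v)` is a directed edge of `T`, that is, `v` is a child of `u`. -/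
def IsEdge {C : Type} (T : ColouredTree C) (u v : Vertex C) : Prop :=
  ∃ k i, i < T.2 u k ∧ v = (k, i) :: u

/-! ### The multi-type Galton-Watson tree -/

/-- The law of the offspring counts of all vertices of the multi-type Galton-Watson tree whose root
has colour `j`: the vectors of offspring counts of different vertices are independent, and that of
a vertex of colour `k` has law `χ k`. -/
noncomputable def gwFrom {C : Type} [Fintype C] (χ : C → PMF (C → ℕ)) (j : C) :
    Measure (Vertex C → C → ℕ) :=
  Measure.infinitePi fun v => (χ (colour j v)).toMeasure

/-- The law of the multi-type Galton-Watson tree: the colour of the root has law `ρ`, and given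
that it is `j`, the offspring counts have law `gwFrom χ j`. -/
noncomputable def gwTree {C : Type} [Fintype C] [MeasurableSpace C] (ρ : PMF C)
    (χ : C → PMF (C → ℕ)) : Measure (ColouredTree C) :=
  ∑ j, ρ j • (Measure.dirac j).prod (gwFrom χ j)

/-! ### The games -/

/-- The two players: `P1` (called Stopper in the escape game), `P2` (called Escaper there). -/
inductive Player
  | P1
  | P2

/-- The opponent of a player. -/
def Player.other : Player → Player
  | .P1 => .P2
  | .P2 => .P1

/-- The player whose turn it is in round `n` (`n = 0, 1, 2, …`) if `i` plays the first round. -/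
def turn (i : Player) : ℕ → Player
  | 0 => i
  | n + 1 => (turn i n).other

/-- The edges `(u, v)` along which a player may move the token: those with `σ(v) ∈ S (σ(u))` for
`P1` / Stopper, those with `σ(v) ∉ S (σ(u))` for `P2` / Escaper. -/
def Permissible {C : Type} (S : C → Set C) (T : ColouredTree C) : Player → Vertex C → Vertex C → Prop
  | .P1, u, v => IsEdge T u v ∧ colour T.1 v ∈ S (colour T.1 u)
  | .P2, u, v => IsEdge T u v ∧ colour T.1 v ∉ S (colour T.1 u)

/-- Player `a` is unable to make a move from `u`. -/
def Stuck {C : Type} (S : C → Set C) (T : ColouredTree C) (a : Player) (u : Vertex C) : Prop :=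
  ∀ v, ¬ Permissible S T a u v

/-- `f` is a strategy for player `a`: it prescribes a permissible move at every vertex from which
`a` has one. As the graph is a rooted tree, the position of the token determines the history of the
play, so that nothing is lost by letting the moves depend on the position alone. -/
def IsStrategy {C : Type} (S : C → Set C) (T : ColouredTree C) (a : Player)
    (f : Vertex C → Vertex C) : Prop :=
  ∀ u, ¬ Stuck S T a u → Permissible S T a u (f u)

/-- The position of the token before round `n`, when it starts at `v`, player `i` plays the first
round, and each player `a` follows the strategy `s a`. (Meaningless after a player failed to make a
move; only the first such failure matters below.) -/
def position {C : Type} (s : Player → Vertex C → Vertex C) (i : Player) (v : Vertex C) :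
    ℕ → Vertex C
  | 0 => v
  | n + 1 => s (turn i n) (position s i v n)

/-- The play comes to an end, and the first player who fails to make a move is `a`. -/
def FailsFirst {C : Type} (S : C → Set C) (T : ColouredTree C) (s : Player → Vertex C → Vertex C)
    (i : Player) (v : Vertex C) (a : Player) : Prop :=
  ∃ n, turn i n = a ∧ Stuck S T (turn i n) (position s i v n) ∧
    ∀ m < n, ¬ Stuck S T (turn i m) (position s i v m)

/-- The three kinds of games. -/
inductive Game
  | normal
  | misere
  | escape

/-- Player `a` wins the play in which the token starts at `v`, player `i` plays the first round, and
the strategies `s` are followed. Normal game: the player who first fails to make a move loses.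
Misère game: the player who first fails to make a move wins. Escape game: Stopper wins if either
player fails to make a move, otherwise Escaper wins. -/
def WinsPlay {C : Type} (S : C → Set C) (T : ColouredTree C) (s : Player → Vertex C → Vertex C)
    (i : Player) (v : Vertex C) : Game → Player → Prop
  | .normal, a => FailsFirst S T s i v a.other
  | .misere, a => FailsFirst S T s i v a
  | .escape, .P1 => ∃ b, FailsFirst S T s i v b
  | .escape, .P2 => ¬ ∃ b, FailsFirst S T s i v b

/-- Player `a` wins the game `g` that starts at `v` with player `i` playing the first round: `a` has
a strategy that wins against every strategy of the opponent. -/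
def Wins {C : Type} (S : C → Set C) (T : ColouredTree C) (g : Game) (i : Player) (v : Vertex C)
    (a : Player) : Prop :=
  ∃ f, IsStrategy S T a f ∧ ∀ s : Player → Vertex C → Vertex C, s a = f →
    IsStrategy S T a.other (s a.other) → WinsPlay S T s i v g a

/-- Player `a` loses the game `g`: the opponent wins it. -/
def Loses {C : Type} (S : C → Set C) (T : ColouredTree C) (g : Game) (i : Player) (v : Vertex C)
    (a : Player) : Prop :=
  Wins S T g i v a.other

/-- The (normal or misère) game results in a draw: neither player wins it. -/
def Draw {C : Type} (S : C → Set C) (T : ColouredTree C) (g : Game) (i : Player)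
    (v : Vertex C) : Prop :=
  ∀ a, ¬ Wins S T g i v a

/-! ### The bi-type binary Galton-Watson tree -/

/-- The two colours. -/
inductive Colour
  | blue
  | red
  deriving DecidableEq

instance : Fintype Colour := ⟨{.blue, .red}, fun x => by cases x <;> decide⟩

instance : MeasurableSpace Colour := ⊤

/-- The four possible sets of children of a vertex in the bi-type binary tree: no child, two blue
children, two red children, one blue and one red child. -/
inductive Brood
  | none
  | bb
  | rr
  | br

/-- The number of children of each colour. -/
def Brood.count : Brood → Colour → ℕ
  | .none, _ => 0
  | .bb, .blue => 2
  | .bb, .red => 0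
  | .rr, .blue => 0
  | .rr, .red => 2
  | .br, _ => 1

/-- The offspring laws of the bi-type binary tree: the children of a blue vertex are chosen
according to `p = (p₀, p_bb, p_rr, p_br)`, those of a red vertex according to
`q = (q₀, q_bb, q_rr, q_br)`. -/
noncomputable def binaryOffspring (p q : PMF Brood) : Colour → PMF (Colour → ℕ)
  | .blue => p.map Brood.count
  | .red => q.map Brood.count

/-- `P1` / Stopper moves along monochromatic edges, `P2` / Escaper along non-monochromatic ones. -/
def mono (j : Colour) : Set Colour := {j}

/-- The probability that the game `g` on the bi-type binary tree, started at the root with player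
`i` playing the first round, results in a draw, conditioned on the root having colour `j`. -/
noncomputable def drawProb (ρ : PMF Colour) (p q : PMF Brood) (g : Game) (i : Player)
    (j : Colour) : ENNReal :=
  ProbabilityTheory.cond (gwTree ρ (binaryOffspring p q)) {T | T.1 = j} {T | Draw mono T g i []}

/-- The probability that Stopper loses the escape game on the bi-type binary tree, started at the
root with Stopper playing the first round, conditioned on the root having colour `j`. -/
noncomputable def stopperLossProb (ρ : PMF Colour) (p q : PMF Brood) (j : Colour) : ENNReal :=
  ProbabilityTheory.cond (gwTree ρ (binaryOffspring p q)) {T | T.1 = j}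
    {T | Loses mono T .escape .P1 [] .P1}

end GWGame

namespace GWGame

/-! ### Forced wins -/

section Games

variable {C : Type} {S : C → Set C} {T : ColouredTree C}

/-! If `p .br = q .br = 1`, then almost surely every vertex has one child of each colour, nobody
ever fails to move, and the claim is immediate.

Otherwise it suffices that almost surely some player forces a win within finitely many rounds. The
three games differ only in the map `o` from the player who fails first to the winner, so one
argument covers them all. By independence of disjoint subtrees, the probabilities of forcing a win
within `n` rounds obey a recursion (`measureReal_forcedWinSet`). They increase to limits `x a i k`
that solve it. Let `d i k = 1 - x .P1 i k - x .P2 i k`. Subtracting the recursions for the two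
players cancels every term involving `o` and factors: `d i k = d i.other k' * (b k + c i k 2 * s)`,
where `k'` is the colour moved to, `b k` the probability of a mixed brood, `c i k 2` that of two
moves, and `0 ≤ s ≤ 2`.

P1 keeps the colour and P2 switches it, so two rounds give `d .P1 k = d .P1 k' * K k`, with `k'` the
other colour. The two factors of `K k` have sum at most 2, because a mixed brood serves both players
and `bb`, `rr` serve one each; so `K k ≤ 1` by AM-GM. Applying this to both colours, `d .P1` is the
same for both. If it were positive, then `K l < 1` at a colour with `b l < 1`, a contradiction
(`add_eq_one_of_stepProb`). -/

@[simp] lemma Player.other_other (i : Player) : i.other.other = i := by cases i <;> rfl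

lemma Player.other_ne (i : Player) : i.other ≠ i := by cases i <;> simp [Player.other]

lemma Player.eq_or_eq_other (i a : Player) : i = a ∨ i = a.other := by
  cases i <;> cases a <;> simp [Player.other]

/-- Player `a` can force a win within `n` rounds when the token is at the given vertex, it is the
turn of the given player, and `o b` is the winner of a play in which `b` is the first to fail to
make a move. -/
def ForcedWin (S : C → Set C) (T : ColouredTree C) (o : Player → Player) (a : Player) :
    ℕ → Player → Vertex C → Prop
  | 0, _, _ => False
  | n + 1, i, u =>
    (Stuck S T i u ∧ o i = a) ∨
    (i = a ∧ ∃ v, Permissible S T i u v ∧ ForcedWin S T o a n i.other v) ∨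
    (i ≠ a ∧ ¬ Stuck S T i u ∧ ∀ v, Permissible S T i u v → ForcedWin S T o a n i.other v)

lemma ForcedWin.succ {o : Player → Player} {a : Player} {n : ℕ} :
    ∀ {i : Player} {u : Vertex C}, ForcedWin S T o a n i u → ForcedWin S T o a (n + 1) i u := by
  induction n with
  | zero => intro i u h; exact h.elim
  | succ n ih =>
    rintro i u (h | ⟨hi, v, hv, h⟩ | ⟨hi, hs, h⟩)
    · exact Or.inl h
    · exact Or.inr (Or.inl ⟨hi, v, hv, ih h⟩)
    · exact Or.inr (Or.inr ⟨hi, hs, fun v hv => ih (h v hv)⟩)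

/-- By induction: the good move of the player to move leads to a vertex where the opponent's forced
win must persist too. This makes the two winning events disjoint. -/
lemma ForcedWin.not_other {o : Player → Player} {a : Player} {n : ℕ} :
    ∀ {i : Player} {u : Vertex C}, ForcedWin S T o a n i u →
      ¬ ForcedWin S T o a.other n i u := by
  induction n with
  | zero => intro i u h; exact h.elim
  | succ n ih =>
    rintro i u (⟨hs, ho⟩ | ⟨hi, v, hv, h⟩ | ⟨hi, hs, h⟩) (⟨hs', ho'⟩ | ⟨hi', v', hv', h'⟩ | ⟨hi', hs', h'⟩)
    · exact a.other_ne (ho'.symm.trans ho)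
    · exact hs _ hv'
    · exact hs' hs
    · exact hs' _ hv
    · exact a.other_ne (hi'.symm.trans hi)
    · exact ih h (h' v hv)
    · exact hs hs'
    · exact ih (h v' hv') h'
    · exact (i.eq_or_eq_other a).elim hi hi'

lemma turn_succ (i : Player) (n : ℕ) : turn i (n + 1) = turn i.other n := by
  induction n with
  | zero => rfl
  | succ n ih => rw [turn, ih, turn]

lemma position_succ (s : Player → Vertex C → Vertex C) (i : Player) (u : Vertex C) (n : ℕ) :
    position s i u (n + 1) = position s i.other (s i u) n := by
  induction n with
  | zero => rfl
  | succ n ih => rw [position, ih, turn_succ, position]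

lemma FailsFirst.of_stuck {s : Player → Vertex C → Vertex C} {i : Player} {u : Vertex C}
    (h : Stuck S T i u) : FailsFirst S T s i u i :=
  ⟨0, rfl, h, fun _ hm => absurd hm (Nat.not_lt_zero _)⟩

lemma FailsFirst.of_succ {s : Player → Vertex C → Vertex C} {i b : Player} {u : Vertex C}
    (hu : ¬ Stuck S T i u) (h : FailsFirst S T s i.other (s i u) b) : FailsFirst S T s i u b := by
  obtain ⟨n, hn, hs, hm⟩ := h
  refine ⟨n + 1, by rwa [turn_succ], by rwa [turn_succ, position_succ], fun m hmn => ?_⟩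
  cases m with
  | zero => exact hu
  | succ m => rw [turn_succ, position_succ]; exact hm m (by omega)

lemma exists_isStrategy (S : C → Set C) (T : ColouredTree C) (a : Player) :
    ∃ f, IsStrategy S T a f := by
  have h : ∀ u, ∃ v, ¬ Stuck S T a u → Permissible S T a u v := fun u => by
    by_cases hu : Stuck S T a u
    · exact ⟨u, fun h => absurd hu h⟩
    · obtain ⟨v, hv⟩ := not_forall_not.1 hu
      exact ⟨v, fun _ => hv⟩
  choose f hf using h
  exact ⟨f, hf⟩

/-- A strategy that moves, whenever possible, to a vertex from which the win is forced within the
least number of rounds. -/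
lemma exists_quickest_strategy (S : C → Set C) (T : ColouredTree C) (o : Player → Player)
    (a : Player) : ∃ f, IsStrategy S T a f ∧ ∀ u v n, Permissible S T a u v →
      ForcedWin S T o a n a.other v → ∃ m ≤ n, ForcedWin S T o a m a.other (f u) := by
  classical
  have h : ∀ u, ∃ w, (¬ Stuck S T a u → Permissible S T a u w) ∧ ∀ v n, Permissible S T a u v →
      ForcedWin S T o a n a.other v → ∃ m ≤ n, ForcedWin S T o a m a.other w := fun u => by
    by_cases hu : ∃ n v, Permissible S T a u v ∧ ForcedWin S T o a n a.other v
    · obtain ⟨w, hw, hf⟩ := Nat.find_spec hu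
      exact ⟨w, fun _ => hw, fun v n hv hn => ⟨Nat.find hu, Nat.find_min' hu ⟨v, hv, hn⟩, hf⟩⟩
    · obtain ⟨f, hf⟩ := exists_isStrategy S T a
      exact ⟨f u, hf u, fun v n hv hn => absurd ⟨n, v, hv, hn⟩ hu⟩
  choose f hf using h
  exact ⟨f, fun u => (hf u).1, fun u => (hf u).2⟩

/-- The winner of the play if the player `b` is the first to fail to make a move. -/
def Game.winner : Game → Player → Player
  | .normal, b => b.other
  | .misere, b => b
  | .escape, _ => .P1

lemma ForcedWin.wins {g : Game} {i a : Player} {u : Vertex C} {n : ℕ}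
    (h : ForcedWin S T g.winner a n i u) : Wins S T g i u a := by
  obtain ⟨f, hf, hq⟩ := exists_quickest_strategy S T g.winner a
  refine ⟨f, hf, fun s hs hs' => ?_⟩
  have key : ∃ b, g.winner b = a ∧ FailsFirst S T s i u b := by
    clear hf
    -- The strategy sees only the position, not the number of rounds left, so it may reach a win
    -- with any bound `m ≤ n`; hence strong induction.
    induction n using Nat.strong_induction_on generalizing i u with
    | _ n ih =>
      cases n with
      | zero => exact h.elim
      | succ n =>
        rcases h with ⟨hst, ho⟩ | ⟨rfl, v, hv, hn⟩ | ⟨hi, hst, hn⟩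
        · exact ⟨i, ho, .of_stuck hst⟩
        · obtain ⟨m, hm, hw⟩ := hq u v n hv hn
          obtain ⟨b, hb, hfail⟩ := ih m (by omega) hw
          exact ⟨b, hb, .of_succ (fun hst => hst v hv) (by rwa [hs])⟩
        · obtain rfl := (i.eq_or_eq_other a).resolve_left hi
          obtain ⟨b, hb, hfail⟩ := ih n (by omega) (hn _ (hs' u hst))
          exact ⟨b, hb, .of_succ hst hfail⟩
  obtain ⟨b, hb, hfail⟩ := key
  cases g with
  | normal => subst hb; simpa [Game.winner, WinsPlay] using hfail
  | misere => subst hb; exact hfail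
  | escape => subst hb; exact ⟨b, hfail⟩

/-- The two players cannot both win the escape game. -/
lemma Wins.not_wins_escape {i : Player} {u : Vertex C} (h : Wins S T .escape i u .P1) :
    ¬ Wins S T .escape i u .P2 := by
  rintro ⟨f₂, hf₂, h₂⟩
  obtain ⟨f₁, hf₁, h₁⟩ := h
  let s : Player → Vertex C → Vertex C
    | .P1 => f₁
    | .P2 => f₂
  exact h₂ s rfl hf₁ (h₁ s rfl hf₂)

/-- Escaper wins only infinite plays, and every failure to move is credited to Stopper. -/
lemma not_forcedWin_escape (n : ℕ) : ∀ (i : Player) (u : Vertex C),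
    ¬ ForcedWin S T Game.escape.winner .P2 n i u := by
  induction n with
  | zero => intro i u h; exact h
  | succ n ih =>
    rintro i u (⟨-, ho⟩ | ⟨-, v, -, h⟩ | ⟨-, hs, h⟩)
    · cases ho
    · exact ih _ _ h
    · obtain ⟨v, hv⟩ := not_forall_not.1 hs
      exact ih _ _ (h v hv)

lemma not_draw_of_forcedWin {g : Game} {i a : Player} {u : Vertex C} {n : ℕ}
    (h : ForcedWin S T g.winner a n i u) : ¬ Draw S T g i u :=
  fun hd => hd a h.wins

lemma not_loses_escape_of_forcedWin {i a : Player} {u : Vertex C} {n : ℕ}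
    (h : ForcedWin S T Game.escape.winner a n i u) : ¬ Loses S T .escape i u .P1 := by
  cases a with
  | P1 => exact h.wins.not_wins_escape
  | P2 => exact (not_forcedWin_escape n i u h).elim

lemma not_failsFirst_of_not_stuck (h : ∀ a u, ¬ Stuck S T a u) (s : Player → Vertex C → Vertex C)
    (i : Player) (u : Vertex C) (a : Player) : ¬ FailsFirst S T s i u a :=
  fun ⟨_, _, hs, _⟩ => h _ _ hs

lemma draw_of_not_stuck (h : ∀ a u, ¬ Stuck S T a u) {g : Game} (hg : g ≠ .escape)
    (i : Player) (u : Vertex C) : Draw S T g i u := by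
  rintro a ⟨f, hf, hw⟩
  obtain ⟨f', hf'⟩ := exists_isStrategy S T a.other
  classical
  have := hw (fun b => if b = a then f else f') (by simp)
    (by simpa [Player.other_ne] using hf')
  cases g with
  | normal => exact not_failsFirst_of_not_stuck h _ _ _ _ this
  | misere => exact not_failsFirst_of_not_stuck h _ _ _ _ this
  | escape => exact hg rfl

lemma loses_escape_of_not_stuck (h : ∀ a u, ¬ Stuck S T a u) (i : Player) (u : Vertex C) :
    Loses S T .escape i u .P1 := by
  obtain ⟨f, hf⟩ := exists_isStrategy S T .P2
  exact ⟨f, hf, fun s _ _ ⟨b, hb⟩ => not_failsFirst_of_not_stuck h _ _ _ _ hb⟩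

end Games
/-! ### Independence of disjoint subtrees -/

section Independence

open ProbabilityTheory

variable {C : Type}

/-- The addresses of the descendants of `u`, including `u` itself. -/
def below (u : Vertex C) : Set (Vertex C) := {v | u <:+ v}

lemma self_mem_below (u : Vertex C) : u ∈ below u := List.suffix_refl u

lemma below_child_subset (u : Vertex C) (x : C × ℕ) : below (x :: u) ⊆ below u :=
  fun _ hv => (List.suffix_cons x u).trans hv

lemma notMem_below_child (u : Vertex C) (x : C × ℕ) : u ∉ below (x :: u) := fun h => by
  have := List.IsSuffix.length_le h
  simp at this

/-- Two suffixes of the same list with equal length coincide. -/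
lemma disjoint_below_children (u : Vertex C) {x y : C × ℕ} (hxy : x ≠ y) :
    Disjoint (below (x :: u)) (below (y :: u)) := by
  refine Set.disjoint_left.2 fun v hx hy => hxy ?_
  have h := (List.suffix_of_suffix_length_le hx hy (by simp)).eq_of_length (by simp)
  exact (List.cons.inj h).1

/-- The σ-algebra generated by the offspring counts of the vertices in `D`. -/
abbrev offspringField (D : Set (Vertex C)) : MeasurableSpace (Vertex C → C → ℕ) :=
  ⨆ v ∈ D, MeasurableSpace.comap (fun t : Vertex C → C → ℕ => t v) inferInstance

lemma offspringField_mono {D E : Set (Vertex C)} (h : D ⊆ E) :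
    offspringField D ≤ offspringField E :=
  biSup_mono fun _ hv => h hv

lemma offspringField_le (D : Set (Vertex C)) : offspringField D ≤ MeasurableSpace.pi :=
  iSup₂_le fun v _ => (measurable_pi_apply v).comap_le

lemma measurableSet_offspringField {D : Set (Vertex C)} {u : Vertex C} (hu : u ∈ D)
    {B : Set (C → ℕ)} (hB : MeasurableSet B) :
    MeasurableSet[offspringField D] {t | t u ∈ B} :=
  le_iSup₂ (f := fun v (_ : v ∈ D) =>
    MeasurableSpace.comap (fun t : Vertex C → C → ℕ => t v) inferInstance) u hu _ ⟨B, hB, rfl⟩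

lemma measurableSet_count (k : C) (B : Set ℕ) : MeasurableSet {f : C → ℕ | f k ∈ B} :=
  measurable_pi_apply k (MeasurableSet.of_discrete (s := B))

variable [Fintype C] (χ : C → PMF (C → ℕ)) (j : C)

instance : IsProbabilityMeasure (gwFrom χ j) := by unfold gwFrom; infer_instance

lemma gwFrom_eval (u : Vertex C) {B : Set (C → ℕ)} (hB : MeasurableSet B) :
    gwFrom χ j {t | t u ∈ B} = (χ (colour j u)).toMeasure B :=
  (measurePreserving_eval_infinitePi (fun v => (χ (colour j v)).toMeasure) u).measure_preimage
    hB.nullMeasurableSet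

lemma indep_offspringField {D E : Set (Vertex C)} (h : Disjoint D E) :
    Indep (offspringField D) (offspringField E) (gwFrom χ j) :=
  indep_iSup_of_disjoint (fun v => (measurable_pi_apply v).comap_le)
    (iIndepFun_infinitePi (X := fun _ ω => ω) (fun _ => measurable_id)) h

lemma measureReal_inter_of_disjoint {D E : Set (Vertex C)} (h : Disjoint D E)
    {A B : Set (Vertex C → C → ℕ)} (hA : MeasurableSet[offspringField D] A)
    (hB : MeasurableSet[offspringField E] B) :
    (gwFrom χ j).real (A ∩ B) = (gwFrom χ j).real A * (gwFrom χ j).real B := by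
  simp only [measureReal_def, ← ENNReal.toReal_mul]
  rw [(Indep_iff _ _ _).1 (indep_offspringField χ j h) A B hA hB]

/-- The probability that a vertex of colour `l` has exactly `m` children of colour `k`. -/
noncomputable def countProb (l k : C) (m : ℕ) : ℝ :=
  (χ l).toMeasure.real {f | f k = m}

lemma measureReal_count_eq (u : Vertex C) (k : C) (m : ℕ) :
    (gwFrom χ j).real {t | t u k = m} = countProb χ (colour j u) k m :=
  congrArg ENNReal.toReal (gwFrom_eval χ j u (measurableSet_count k {m}))

/-- The count at `u` and the subtrees of its children are independent, so conditioning on the count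
gives a generating polynomial of degree 2. -/
lemma measureReal_forall_children (u : Vertex C) (k : C)
    (hk : ∀ f ∈ (χ (colour j u)).support, f k ≤ 2) {A : ℕ → Set (Vertex C → C → ℕ)}
    (hA : ∀ m, MeasurableSet[offspringField (below ((k, m) :: u))] (A m)) :
    (gwFrom χ j).real {t | ∀ m < t u k, t ∈ A m} =
      countProb χ (colour j u) k 0 + countProb χ (colour j u) k 1 * (gwFrom χ j).real (A 0) +
        countProb χ (colour j u) k 2 * ((gwFrom χ j).real (A 0) * (gwFrom χ j).real (A 1)) := by
  have hN : ∀ m, MeasurableSet[offspringField {u}] {t : Vertex C → C → ℕ | t u k = m} := fun m =>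
    measurableSet_offspringField (Set.mem_singleton u) (measurableSet_count k {m})
  have hN' : ∀ m, MeasurableSet {t : Vertex C → C → ℕ | t u k = m} := fun m =>
    offspringField_le _ _ (hN m)
  have hA' : ∀ m, MeasurableSet (A m) := fun m => offspringField_le _ _ (hA m)
  have hae : ∀ᵐ t ∂(gwFrom χ j), t u k ≤ 2 := by
    have h := gwFrom_eval χ j u (measurableSet_count k (Set.Iic 2)).compl
    rw [(PMF.toMeasure_apply_eq_zero_iff _ (measurableSet_count k (Set.Iic 2)).compl).2] at h
    · exact h
    · exact Set.disjoint_left.2 fun f hf hf' => hf' (hk f hf)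
  -- The bound 2 on the count holds only almost surely, hence an almost sure equality.
  have hset : {t | ∀ m < t u k, t ∈ A m} =ᵐ[gwFrom χ j]
      (({t | t u k = 0} ∪ {t | t u k = 1} ∩ A 0) ∪ {t | t u k = 2} ∩ (A 0 ∩ A 1) :
        Set (Vertex C → C → ℕ)) := by
    filter_upwards [hae] with t ht
    apply propext
    change (∀ m < t u k, t ∈ A m) ↔ (t u k = 0 ∨ t u k = 1 ∧ t ∈ A 0) ∨ t u k = 2 ∧ t ∈ A 0 ∧ t ∈ A 1
    interval_cases t u k
    · simp
    · simp
    · refine ⟨fun h => Or.inr ⟨rfl, h 0 (by omega), h 1 (by omega)⟩, ?_⟩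
      rintro (h | ⟨-, h0, h1⟩) m hm
      · simp at h
      · interval_cases m <;> assumption
  have hu : ∀ m, Disjoint {u} (below ((k, m) :: u)) := fun m =>
    Set.disjoint_singleton_left.2 (notMem_below_child u _)
  have hAA : MeasurableSet[offspringField (below ((k, 0) :: u) ∪ below ((k, 1) :: u))]
      (A 0 ∩ A 1) :=
    MeasurableSet.inter (offspringField_mono Set.subset_union_left _ (hA 0))
      (offspringField_mono Set.subset_union_right _ (hA 1))
  rw [measureReal_congr hset, measureReal_union _ ((hN' 2).inter ((hA' 0).inter (hA' 1))),
    measureReal_union _ ((hN' 1).inter (hA' 0)),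
    measureReal_inter_of_disjoint χ j (hu 0) (hN 1) (hA 0),
    measureReal_inter_of_disjoint χ j (Set.disjoint_union_right.2 ⟨hu 0, hu 1⟩) (hN 2) hAA,
    measureReal_inter_of_disjoint χ j (disjoint_below_children u (by simp)) (hA 0) (hA 1),
    measureReal_count_eq, measureReal_count_eq, measureReal_count_eq]
  · exact Set.disjoint_left.2 fun t h1 h2 => by
      have h1 : t u k = 0 := h1
      have h2 : t u k = 1 := h2.1
      omega
  · exact Set.disjoint_left.2 fun t h1 h2 => by
      have h1 : t u k = 0 ∨ t u k = 1 ∧ t ∈ A 0 := h1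
      have h2 : t u k = 2 := h2.1
      omega

/-- Only the summand with root colour `j` survives. `E` need not be measurable: `t ↦ (j, t)` is a
measurable embedding, so the image measure can be evaluated on any set. This allows draw events
without a proof that they are measurable. -/
lemma cond_gwTree [MeasurableSpace C] [MeasurableSingletonClass C] (ρ : PMF C) (hj : ρ j ≠ 0)
    (E : Set (ColouredTree C)) :
    cond (gwTree ρ χ) {T | T.1 = j} E = gwFrom χ j {t | (j, t) ∈ E} := by
  have hm : MeasurableSet {T : ColouredTree C | T.1 = j} :=
    measurable_fst (measurableSet_singleton j)
  have key : ∀ F : Set (ColouredTree C),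
      gwTree ρ χ ({T | T.1 = j} ∩ F) = ρ j * gwFrom χ j {t | (j, t) ∈ F} := fun F => by
    rw [gwTree, Measure.finsetSum_apply, Finset.sum_eq_single j]
    · rw [Measure.smul_apply, Measure.dirac_prod, (measurableEmbedding_prodMk_left j).map_apply,
        smul_eq_mul]
      congr 2
      ext t
      simp
    · intro l _ hl
      rw [Measure.smul_apply, Measure.dirac_prod, (measurableEmbedding_prodMk_left l).map_apply]
      have : Prod.mk l ⁻¹' ({T : ColouredTree C | T.1 = j} ∩ F) = ∅ := by
        ext t
        simp [hl]
      simp [this]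
    · simp
  have h1 := key Set.univ
  simp only [Set.inter_univ, Set.mem_univ, Set.ofPred_true, measure_univ, mul_one] at h1
  rw [cond_apply hm, key, h1, ← mul_assoc, ENNReal.inv_mul_cancel hj (ρ.apply_ne_top j), one_mul]

end Independence
/-! ### The winning probabilities in the bi-type binary tree -/

section Binary

/-- The colour of the vertices to which a player may move from a vertex of a given colour. -/
def target : Player → Colour → Colour
  | .P1, k => k
  | .P2, .blue => .red
  | .P2, .red => .blue

/-- With only two colours, "the other colour" is a single one, so the number of moves of either
player is a single offspring count. -/
lemma permissible_mono_iff {j : Colour} {t : Vertex Colour → Colour → ℕ} {i : Player}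
    {u v : Vertex Colour} : Permissible mono (j, t) i u v ↔
      ∃ m < t u (target i (colour j u)), v = (target i (colour j u), m) :: u := by
  constructor
  · cases i with
    | P1 =>
      rintro ⟨⟨k, m, hm, rfl⟩, hk⟩
      obtain rfl : k = colour j u := hk
      exact ⟨m, hm, rfl⟩
    | P2 =>
      rintro ⟨⟨k, m, hm, rfl⟩, hk⟩
      have hk : k ≠ colour j u := hk
      obtain rfl : k = target .P2 (colour j u) := by
        revert hk
        cases k <;> cases colour j u <;> simp [target]
      exact ⟨m, hm, rfl⟩
  · rintro ⟨m, hm, rfl⟩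
    cases i with
    | P1 => exact ⟨⟨_, m, hm, rfl⟩, rfl⟩
    | P2 =>
      refine ⟨⟨_, m, hm, rfl⟩, fun h => ?_⟩
      have h : target .P2 (colour j u) = colour j u := h
      revert h
      cases colour j u <;> simp [target]

lemma stuck_mono_iff {j : Colour} {t : Vertex Colour → Colour → ℕ} {i : Player}
    {u : Vertex Colour} : Stuck mono (j, t) i u ↔ t u (target i (colour j u)) = 0 := by
  simp only [Stuck, permissible_mono_iff]
  constructor
  · intro h
    by_contra h0
    exact h _ ⟨0, Nat.pos_of_ne_zero h0, rfl⟩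
  · rintro h v ⟨m, hm, -⟩
    omega

/-- The offspring counts for which player `a` can force a win within `n` rounds. -/
def forcedWinSet (o : Player → Player) (j : Colour) (a : Player) (n : ℕ) (i : Player)
    (u : Vertex Colour) : Set (Vertex Colour → Colour → ℕ) :=
  {t | ForcedWin mono (j, t) o a n i u}

variable {o : Player → Player} {j : Colour} {a : Player}

/-- The existence of a winning move is written as the complement of "all children fail", the form
that `measureReal_forall_children` evaluates. The case of no move is added separately, according to
`o`. -/
lemma forcedWinSet_succ_self (n : ℕ) (u : Vertex Colour) :
    forcedWinSet o j a (n + 1) a u =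
      {t | ∀ m < t u (target a (colour j u)),
        t ∈ (forcedWinSet o j a n a.other ((target a (colour j u), m) :: u))ᶜ}ᶜ ∪
      {t | t u (target a (colour j u)) = 0 ∧ o a = a} := by
  ext t
  change ForcedWin mono (j, t) o a (n + 1) a u ↔
    ¬ (∀ m < _, ¬ ForcedWin mono (j, t) o a n a.other _) ∨ (_ ∧ _)
  simp only [ForcedWin, permissible_mono_iff, stuck_mono_iff]
  constructor
  · rintro (h | ⟨-, _, ⟨m, hm, rfl⟩, hw⟩ | ⟨h, -⟩)
    · exact Or.inr h
    · exact Or.inl fun h => h m hm hw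
    · exact absurd rfl h
  · rintro (h | h)
    · push Not at h
      obtain ⟨m, hm, hw⟩ := h
      exact Or.inr (Or.inl ⟨trivial, _, ⟨m, hm, rfl⟩, hw⟩)
    · exact Or.inl h

/-- The universal condition holds vacuously when there is no move, so that case is removed when `o`
does not award it to `a`. -/
lemma forcedWinSet_succ_of_ne {i : Player} (hi : i ≠ a) (n : ℕ) (u : Vertex Colour) :
    forcedWinSet o j a (n + 1) i u =
      {t | ∀ m < t u (target i (colour j u)),
        t ∈ forcedWinSet o j a n i.other ((target i (colour j u), m) :: u)} \
      {t | t u (target i (colour j u)) = 0 ∧ o i ≠ a} := by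
  ext t
  change ForcedWin mono (j, t) o a (n + 1) i u ↔
    (∀ m < _, ForcedWin mono (j, t) o a n i.other _) ∧ ¬ (_ ∧ _)
  simp only [ForcedWin, permissible_mono_iff, stuck_mono_iff]
  constructor
  · rintro (⟨h, ho⟩ | ⟨h, -⟩ | ⟨-, h, hw⟩)
    · exact ⟨fun m hm => by omega, fun h' => h'.2 ho⟩
    · exact absurd h hi
    · exact ⟨fun m hm => hw _ ⟨m, hm, rfl⟩, fun h' => h h'.1⟩
  · rintro ⟨hw, h⟩
    by_cases h0 : t u (target i (colour j u)) = 0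
    · exact Or.inl ⟨h0, by_contra fun ho => h ⟨h0, ho⟩⟩
    · refine Or.inr (Or.inr ⟨hi, h0, ?_⟩)
      rintro _ ⟨m, hm, rfl⟩
      exact hw m hm

lemma measurableSet_count_and {u : Vertex Colour} (k : Colour) (P : Prop) :
    MeasurableSet[offspringField (below u)]
      {t : Vertex Colour → Colour → ℕ | t u k = 0 ∧ P} := by
  by_cases hP : P
  · simp only [hP, and_true]
    exact measurableSet_offspringField (self_mem_below u) (measurableSet_count k {0})
  · simp only [hP, and_false]
    exact @MeasurableSet.empty _ (offspringField _)

lemma measurableSet_forall_children {u : Vertex Colour} {k : Colour}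
    {A : ℕ → Set (Vertex Colour → Colour → ℕ)}
    (hA : ∀ m, MeasurableSet[offspringField (below ((k, m) :: u))] (A m)) :
    MeasurableSet[offspringField (below u)] {t | ∀ m < t u k, t ∈ A m} := by
  have : {t | ∀ m < t u k, t ∈ A m} = ⋂ m, ({t | t u k ∈ Set.Iic m} ∪ A m) := by
    ext t
    simp only [Set.mem_iInter]
    refine forall_congr' fun m => ?_
    change (m < t u k → t ∈ A m) ↔ t u k ≤ m ∨ t ∈ A m
    rw [← not_lt, ← imp_iff_not_or]
  rw [this]
  exact MeasurableSet.iInter fun m =>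
    (measurableSet_offspringField (self_mem_below u) (measurableSet_count k (Set.Iic m))).union
      (offspringField_mono (below_child_subset u _) _ (hA m))

lemma measurableSet_forcedWinSet (n : ℕ) : ∀ (i : Player) (u : Vertex Colour),
    MeasurableSet[offspringField (below u)] (forcedWinSet o j a n i u) := by
  induction n with
  | zero => intro i u; exact @MeasurableSet.empty _ (offspringField _)
  | succ n ih =>
    intro i u
    by_cases hi : i = a
    · subst hi
      rw [forcedWinSet_succ_self]
      exact (measurableSet_forall_children fun m => (ih _ _).compl).compl.union
        (measurableSet_count_and _ _)
    · rw [forcedWinSet_succ_of_ne hi]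
      exact (measurableSet_forall_children fun m => ih _ _).diff (measurableSet_count_and _ _)

/-! ### Recursion for the winning probabilities -/

open Classical in
/-- One step of the recursion for the winning probabilities of player `a`: player `i` is to move,
she has `m` permissible moves with probability `c m`, and `y` is the winning probability after each
of them. -/
noncomputable def stepProb (c : ℕ → ℝ) (o : Player → Player) (a i : Player) (y : ℝ) : ℝ :=
  if i = a then
    1 - (c 0 + c 1 * (1 - y) + c 2 * ((1 - y) * (1 - y))) + (if o i = a then c 0 else 0)
  else c 0 + c 1 * y + c 2 * (y * y) - (if o i = a then 0 else c 0)

/-- The probability that player `a` can force a win within `n` rounds, where `c i k m` is the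
probability that player `i` has `m` permissible moves from a vertex of colour `k`. -/
noncomputable def winProb (c : Player → Colour → ℕ → ℝ) (o : Player → Player) (a : Player) :
    ℕ → Player → Colour → ℝ
  | 0, _, _ => 0
  | n + 1, i, k => stepProb (c i k) o a i (winProb c o a n i.other (target i k))

/-- The probability that player `i` has `m` permissible moves from a vertex of colour `k`. -/
noncomputable def moveProb (χ : Colour → PMF (Colour → ℕ)) (i : Player) (k : Colour) (m : ℕ) : ℝ :=
  countProb χ k (target i k) m

variable {χ : Colour → PMF (Colour → ℕ)}

lemma measureReal_count_and (u : Vertex Colour) (i : Player) (P : Prop) [Decidable P] :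
    (gwFrom χ j).real {t | t u (target i (colour j u)) = 0 ∧ P} =
      if P then moveProb χ i (colour j u) 0 else 0 := by
  split_ifs with hP
  · simp only [hP, and_true]
    exact measureReal_count_eq χ j u _ 0
  · simp [hP]

/-- The probability depends on `u` only through its colour, so both children in a pair contribute
the same value. -/
lemma measureReal_forcedWinSet (hχ : ∀ k, ∀ f ∈ (χ k).support, ∀ l, f l ≤ 2) (n : ℕ) :
    ∀ (i : Player) (u : Vertex Colour), (gwFrom χ j).real (forcedWinSet o j a n i u) =
      winProb (moveProb χ) o a n i (colour j u) := by
  classical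
  induction n with
  | zero => intro i u; exact measureReal_empty
  | succ n ih =>
    intro i u
    have hdef : winProb (moveProb χ) o a (n + 1) i (colour j u) =
      stepProb (moveProb χ i (colour j u)) o a i
        (winProb (moveProb χ) o a n i.other (target i (colour j u))) := rfl
    have hA := fun m => measurableSet_forcedWinSet (o := o) (j := j) (a := a) n i.other
      ((target i (colour j u), m) :: u)
    have hA' := fun m => offspringField_le _ _ (hA m)
    have hz := fun P => offspringField_le _ _
      (measurableSet_count_and (u := u) (target i (colour j u)) P)
    rw [hdef, stepProb]
    by_cases hi : i = a
    · subst hi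
      have hAc := fun m => (hA m).compl
      rw [if_pos rfl, forcedWinSet_succ_self, measureReal_union _ (hz _), measureReal_count_and,
        probReal_compl_eq_one_sub (offspringField_le _ _ (measurableSet_forall_children hAc)),
        measureReal_forall_children χ j u _ (fun f hf => hχ _ f hf _) hAc,
        probReal_compl_eq_one_sub (hA' 0), probReal_compl_eq_one_sub (hA' 1), ih, ih]
      · rfl
      · refine Set.disjoint_left.2 fun t h1 h2 => h1 fun m hm => ?_
        have h2 : t u _ = 0 := h2.1
        omega
    · rw [if_neg hi, forcedWinSet_succ_of_ne hi, measureReal_sdiff _ (hz _),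
        measureReal_count_and, measureReal_forall_children χ j u _ (fun f hf => hχ _ f hf _) hA,
        ih, ih]
      · by_cases ho : o i = a <;> simp [ho, moveProb, colour]
      · intro t ht m hm
        have ht : t u _ = 0 := ht.1
        omega

lemma winProb_eq_measureReal (hχ : ∀ k, ∀ f ∈ (χ k).support, ∀ l, f l ≤ 2) (n : ℕ) (i : Player)
    (k : Colour) : winProb (moveProb χ) o a n i k =
      (gwFrom χ k).real (forcedWinSet o k a n i []) :=
  (measureReal_forcedWinSet hχ n i []).symm

lemma winProb_nonneg (hχ : ∀ k, ∀ f ∈ (χ k).support, ∀ l, f l ≤ 2) (n : ℕ) (i : Player)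
    (k : Colour) : 0 ≤ winProb (moveProb χ) o a n i k := by
  rw [winProb_eq_measureReal hχ]
  exact measureReal_nonneg

lemma monotone_winProb (hχ : ∀ k, ∀ f ∈ (χ k).support, ∀ l, f l ≤ 2) (i : Player)
    (k : Colour) : Monotone fun n => winProb (moveProb χ) o a n i k :=
  monotone_nat_of_le_succ fun n => by
    rw [winProb_eq_measureReal hχ, winProb_eq_measureReal hχ]
    exact measureReal_mono fun t ht => ForcedWin.succ ht

lemma measureReal_compl_union_forcedWinSet (hχ : ∀ k, ∀ f ∈ (χ k).support, ∀ l, f l ≤ 2) (n : ℕ)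
    (i : Player) (k : Colour) :
    (gwFrom χ k).real (forcedWinSet o k .P1 n i [] ∪ forcedWinSet o k .P2 n i [])ᶜ =
      1 - (winProb (moveProb χ) o .P1 n i k + winProb (moveProb χ) o .P2 n i k) := by
  have hm : ∀ a, MeasurableSet (forcedWinSet o k a n i []) := fun a =>
    offspringField_le _ _ (measurableSet_forcedWinSet n i [])
  rw [probReal_compl_eq_one_sub ((hm _).union (hm _)), measureReal_union _ (hm _),
    winProb_eq_measureReal hχ, winProb_eq_measureReal hχ]
  exact Set.disjoint_left.2 fun t h1 h2 => ForcedWin.not_other h1 h2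

lemma winProb_add_le_one (hχ : ∀ k, ∀ f ∈ (χ k).support, ∀ l, f l ≤ 2) (n : ℕ) (i : Player)
    (k : Colour) : winProb (moveProb χ) o .P1 n i k + winProb (moveProb χ) o .P2 n i k ≤ 1 := by
  have h := measureReal_compl_union_forcedWinSet (o := o) hχ n i k
  have h' : 0 ≤ (gwFrom χ k).real
    (forcedWinSet o k .P1 n i [] ∪ forcedWinSet o k .P2 n i [])ᶜ := measureReal_nonneg
  linarith

end Binary
-- The limiting recursion has no draws
section Limit

open Filter Topology

/-- If `a + b + c ≤ 1`, the two steps by which the token passes to the other colour do not increase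
the probability of a draw, and they decrease it unless `b = 1`. -/
lemma mul_slopes_le_one {a b c s t : ℝ} (ha : 0 ≤ a) (hb : 0 ≤ b) (hc : 0 ≤ c) (habc : a + b + c ≤ 1)
    (hs : 0 ≤ s) (hs2 : s ≤ 2) (ht : 0 ≤ t) (ht2 : t ≤ 2) : (b + a * s) * (b + c * t) ≤ 1 := by
  have h1 : a * s ≤ a * 2 := mul_le_mul_of_nonneg_left hs2 ha
  have h2 : c * t ≤ c * 2 := mul_le_mul_of_nonneg_left ht2 hc
  have h3 : 0 ≤ a * s := mul_nonneg ha hs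
  have h4 : 0 ≤ c * t := mul_nonneg hc ht
  -- AM-GM: the factors differ by `a * s - c * t` and have sum at most `2 * (a + b + c) ≤ 2`.
  nlinarith [sq_nonneg (a * s - c * t)]

/-- The sum of the factors is now strictly below 2: if `a` or `c` is positive because `s, t < 2`,
and otherwise because `b < 1`. -/
lemma mul_slopes_lt_one {a b c s t : ℝ} (ha : 0 ≤ a) (hb : 0 ≤ b) (hc : 0 ≤ c) (habc : a + b + c ≤ 1)
    (hs : 0 ≤ s) (hs2 : s < 2) (ht : 0 ≤ t) (ht2 : t < 2) (hb1 : b < 1) :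
    (b + a * s) * (b + c * t) < 1 := by
  have h1 : a * s ≤ a * 2 := mul_le_mul_of_nonneg_left hs2.le ha
  have h2 : c * t ≤ c * 2 := mul_le_mul_of_nonneg_left ht2.le hc
  have h3 : 0 ≤ a * s := mul_nonneg ha hs
  have h4 : 0 ≤ c * t := mul_nonneg hc ht
  have h5 : (b + a * s) + (b + c * t) < 2 := by
    rcases ha.eq_or_lt with rfl | ha
    · rcases hc.eq_or_lt with rfl | hc
      · linarith
      · linarith [mul_lt_mul_of_pos_left ht2 hc]
    · linarith [mul_lt_mul_of_pos_left hs2 ha]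
  nlinarith [sq_nonneg (a * s - c * t)]

/-- The recursion for the probabilities `x a i k` that player `a` can force a win has only solutions
without draws. -/
lemma add_eq_one_of_stepProb {c : Player → Colour → ℕ → ℝ} {o : Player → Player} {b : Colour → ℝ}
    {x : Player → Player → Colour → ℝ} (hc1 : ∀ i k, c i k 1 = b k) (hb : ∀ k, 0 ≤ b k)
    (hc2 : ∀ i k, 0 ≤ c i k 2)
    (hsum : ∀ k, c .P1 k 2 + b k + c .P2 k 2 ≤ 1) (hb1 : ∃ k, b k ≠ 1)
    (hx : ∀ a i k, 0 ≤ x a i k) (hx1 : ∀ i k, x .P1 i k + x .P2 i k ≤ 1)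
    (hstep : ∀ a i k, x a i k = stepProb (c i k) o a i (x a i.other (target i k)))
    (i : Player) (k : Colour) : x .P1 i k + x .P2 i k = 1 := by
  classical
  set d : Player → Colour → ℝ := fun i k => 1 - x .P1 i k - x .P2 i k with hd
  have hd0 : ∀ i k, 0 ≤ d i k := fun i k => by simp only [hd]; linarith [hx1 i k]
  -- With `y`, `z` the winning probabilities of the mover and the opponent after the move, `(1 -
  -- y)^2 - z^2 = (1 - y - z) * (1 - y + z)`; `s` is the last factor.
  set s : Player → Colour → ℝ := fun i k =>
    1 - x i i.other (target i k) + x i.other i.other (target i k) with hs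
  have hdx : ∀ a i k, d i k = 1 - x a i k - x a.other i k := fun a i k => by
    cases a with
    | P1 => rfl
    | P2 => simp only [hd, Player.other]; ring
  have hs0 : ∀ i k, 0 ≤ s i k := fun i k => by
    simp only [hs]
    linarith [hdx i i.other (target i k), hd0 i.other (target i k),
      hx i.other i.other (target i k)]
  have hs2 : ∀ i k, s i k + d i.other (target i k) ≤ 2 := fun i k => by
    simp only [hs, hdx i i.other (target i k)]
    linarith [hx i i.other (target i k)]
  have hds : ∀ i k, d i k = d i.other (target i k) * (b k + c i k 2 * s i k) := fun i k => by
    have h1 := hstep i i k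
    have h2 := hstep i.other i k
    rw [stepProb, if_pos rfl] at h1
    rw [stepProb, if_neg i.other_ne.symm] at h2
    -- A player without a move makes exactly one of the two players win, so the terms with `o`
    -- cancel in `d`.
    have h3 : (if o i = i then c i k 0 else 0) - (if o i = i.other then 0 else c i k 0) = 0 := by
      rcases (o i).eq_or_eq_other i with h | h <;>
        simp [h, i.other_ne, i.other_ne.symm]
    rw [hdx i i k, hdx i i.other (target i k), h1, h2, ← hc1 i k]
    simp only [hs]
    linear_combination -h3
  set K : Colour → ℝ := fun k =>
    (b k + c .P1 k 2 * s .P1 k) * (b k + c .P2 k 2 * s .P2 k) with hK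
  have hs2' : ∀ i k, s i k ≤ 2 := fun i k => by linarith [hs2 i k, hd0 i.other (target i k)]
  have hd1 : ∀ k, d .P1 k = d .P2 k * (b k + c .P1 k 2 * s .P1 k) := hds .P1
  have hd2 : ∀ k, d .P2 k = d .P1 (target .P2 k) * (b k + c .P2 k 2 * s .P2 k) := hds .P2
  have hdK : ∀ k, d .P1 k = d .P1 (target .P2 k) * K k := fun k => by
    rw [hd1, hd2]; simp only [hK]; ring
  have hK1 : ∀ k, K k ≤ 1 := fun k =>
    mul_slopes_le_one (hc2 _ _) (hb k) (hc2 _ _) (hsum k) (hs0 _ _) (hs2' _ _) (hs0 _ _) (hs2' _ _)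
  have hle : ∀ k, d .P1 k ≤ d .P1 (target .P2 k) := fun k => by
    rw [hdK k]; exact mul_le_of_le_one_right (hd0 _ _) (hK1 k)
  obtain ⟨l, hl⟩ := hb1
  have hll : target .P2 (target .P2 l) = l := by cases l <;> rfl
  have hl0 : d .P1 l = 0 := by
    by_contra hne
    have h2 : 0 < d .P2 l := (hd0 _ _).lt_of_ne fun h => hne (by rw [hd1, ← h, zero_mul])
    have h1 : 0 < d .P1 (target .P2 l) :=
      (hd0 _ _).lt_of_ne fun h => hne (by rw [hdK, ← h, zero_mul])
    have hbl : b l < 1 := lt_of_le_of_ne (by linarith [hsum l, hc2 .P1 l, hc2 .P2 l]) hl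
    -- Positive draw probabilities after the move force both slopes `s` strictly below 2.
    have hs1 : s .P1 l + d .P2 l ≤ 2 := hs2 .P1 l
    have hs2 : s .P2 l + d .P1 (target .P2 l) ≤ 2 := hs2 .P2 l
    have hKl : K l < 1 := mul_slopes_lt_one (hc2 _ _) (hb l) (hc2 _ _) (hsum l) (hs0 _ _)
      (by linarith) (hs0 _ _) (by linarith) hbl
    -- Going round both colours: `d .P1 l' ≤ d .P1 l = d .P1 l' * K l < d .P1 l'`, with `l'` the
    -- other colour.
    have h3 := hle (target .P2 l)
    rw [hll, hdK l] at h3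
    linarith [mul_lt_of_lt_one_right h1 hKl]
  have hP1 : ∀ k, d .P1 k = 0 := fun k => by
    have h : k = l ∨ k = target .P2 l := by cases k <;> cases l <;> simp [target]
    rcases h with rfl | rfl
    · exact hl0
    · rw [hdK, hll, hl0, zero_mul]
  have hdi : d i k = 0 := by
    cases i with
    | P1 => exact hP1 k
    | P2 => rw [hd2, hP1, zero_mul]
  simp only [hd] at hdi
  linarith

lemma continuous_stepProb (c : ℕ → ℝ) (o : Player → Player) (a i : Player) :
    Continuous (stepProb c o a i) := by
  unfold stepProb
  by_cases hi : i = a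
  · simp only [if_pos hi]; fun_prop
  · simp only [if_neg hi]; fun_prop

/-- Almost surely one of the players can force a win. -/
lemma ae_exists_forcedWin {χ : Colour → PMF (Colour → ℕ)}
    (hχ : ∀ k, ∀ f ∈ (χ k).support, ∀ l, f l ≤ 2) {b : Colour → ℝ}
    (hc1 : ∀ i k, moveProb χ i k 1 = b k)
    (hsum : ∀ k, moveProb χ .P1 k 2 + b k + moveProb χ .P2 k 2 ≤ 1) (hb1 : ∃ k, b k ≠ 1)
    (o : Player → Player) (i : Player) (k : Colour) :
    ∀ᵐ t ∂(gwFrom χ k), ∃ a n, ForcedWin mono (k, t) o a n i [] := by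
  have hle : ∀ a n i k, winProb (moveProb χ) o a n i k ≤ 1 := fun a n i k => by
    rw [winProb_eq_measureReal hχ]; exact measureReal_le_one
  have hlim : ∀ a i k, ∃ y, Tendsto (fun n => winProb (moveProb χ) o a n i k) atTop (𝓝 y) :=
    fun a i k => ⟨_, tendsto_atTop_ciSup (monotone_winProb hχ i k)
      ⟨1, by rintro _ ⟨n, rfl⟩; exact hle a n i k⟩⟩
  choose x hx using hlim
  have hx1 : x .P1 i k + x .P2 i k = 1 := by
    refine add_eq_one_of_stepProb (c := moveProb χ) (o := o) hc1
      (fun k => hc1 .P1 k ▸ measureReal_nonneg) (fun _ _ => measureReal_nonneg) hsum hb1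
      (fun a i k => ge_of_tendsto' (hx a i k) fun n => winProb_nonneg hχ n i k)
      (fun i k => le_of_tendsto' ((hx .P1 i k).add (hx .P2 i k)) fun n =>
        winProb_add_le_one hχ n i k) (fun a i k => ?_) i k
    -- The shifted sequence has the same limit, and `stepProb` is continuous, so the limits solve
    -- the recursion.
    exact tendsto_nhds_unique ((tendsto_add_atTop_iff_nat 1).2 (hx a i k))
      (((continuous_stepProb (moveProb χ i k) o a i).tendsto _).comp (hx a i.other (target i k)))
  have h0 : Tendsto (fun n => (gwFrom χ k).real
      (forcedWinSet o k .P1 n i [] ∪ forcedWinSet o k .P2 n i [])ᶜ) atTop (𝓝 0) := by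
    have h := ((hx .P1 i k).add (hx .P2 i k)).const_sub 1
    rw [hx1, sub_self] at h
    exact h.congr fun n => (measureReal_compl_union_forcedWinSet hχ n i k).symm
  have hzero : (gwFrom χ k).real {t | ¬ ∃ a n, ForcedWin mono (k, t) o a n i []} = 0 := by
    -- The event that no win can be forced lies in the complement for every `n`, and those measures
    -- tend to 0.
    refine le_antisymm (ge_of_tendsto' h0 fun n => measureReal_mono fun t ht => ?_)
      measureReal_nonneg
    rintro (h | h)
    · exact ht ⟨_, _, h⟩
    · exact ht ⟨_, _, h⟩
  exact (measureReal_eq_zero_iff).1 hzero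

end Limit

/-! ### The offspring laws of the bi-type binary tree -/

section Offspring

/-- The offspring law of the vertices of a given colour. -/
def broodLaw (p q : PMF Brood) : Colour → PMF Brood
  | .blue => p
  | .red => q

/-- Two children of the given colour. -/
def Brood.pair : Colour → Brood
  | .blue => .bb
  | .red => .rr

instance : DecidableEq Brood := fun x y => by
  cases x <;> cases y <;> first | exact isTrue rfl | exact isFalse (by simp)

instance : Fintype Brood := ⟨{.none, .bb, .rr, .br}, fun x => by cases x <;> simp⟩

lemma Brood.count_le_two (x : Brood) (k : Colour) : x.count k ≤ 2 := by
  cases x <;> cases k <;> simp [Brood.count]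

lemma Brood.count_eq_one_iff {x : Brood} {k : Colour} : x.count k = 1 ↔ x = .br := by
  cases x <;> cases k <;> simp [Brood.count]

lemma Brood.count_eq_two_iff {x : Brood} {k : Colour} : x.count k = 2 ↔ x = .pair k := by
  cases x <;> cases k <;> simp [Brood.count, Brood.pair]

variable (p q : PMF Brood)

lemma binaryOffspring_eq_map (k : Colour) :
    binaryOffspring p q k = (broodLaw p q k).map Brood.count := by cases k <;> rfl

lemma le_two_of_mem_support (k : Colour) :
    ∀ f ∈ (binaryOffspring p q k).support, ∀ l, f l ≤ 2 := by
  rw [binaryOffspring_eq_map, PMF.support_map]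
  rintro _ ⟨x, -, rfl⟩ l
  exact x.count_le_two l

lemma sum_broodLaw (k : Colour) :
    (broodLaw p q k .none).toReal + (broodLaw p q k .bb).toReal + (broodLaw p q k .rr).toReal +
      (broodLaw p q k .br).toReal = 1 := by
  have h := (broodLaw p q k).tsum_coe
  rw [tsum_fintype] at h
  have h' := congrArg ENNReal.toReal h
  rw [ENNReal.toReal_sum fun x _ => (broodLaw p q k).apply_ne_top x] at h'
  have hu : (Finset.univ : Finset Brood) = {.none, .bb, .rr, .br} := rfl
  simpa [hu, add_assoc] using h'

lemma countProb_binaryOffspring (k l : Colour) (m : ℕ) :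
    countProb (binaryOffspring p q) k l m =
      ((broodLaw p q k).toOuterMeasure {x | x.count l = m}).toReal := by
  have h := PMF.toMeasure_apply_eq_toOuterMeasure_apply (binaryOffspring p q k)
    (measurableSet_count l {m})
  rw [binaryOffspring_eq_map, PMF.toOuterMeasure_map_apply, ← binaryOffspring_eq_map] at h
  exact congrArg ENNReal.toReal h

/-- Only the mixed brood contains exactly one child of a given colour, so both players have a single
move with the same probability. -/
lemma moveProb_one (i : Player) (k : Colour) :
    moveProb (binaryOffspring p q) i k 1 = (broodLaw p q k .br).toReal := by
  rw [moveProb, countProb_binaryOffspring, ← PMF.toOuterMeasure_apply_singleton]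
  simp only [Brood.count_eq_one_iff]
  rfl

lemma moveProb_two (i : Player) (k : Colour) :
    moveProb (binaryOffspring p q) i k 2 = (broodLaw p q k (.pair (target i k))).toReal := by
  rw [moveProb, countProb_binaryOffspring, ← PMF.toOuterMeasure_apply_singleton]
  simp only [Brood.count_eq_two_iff]
  rfl

/-- The two players need differently coloured pairs, so three distinct broods are involved. -/
lemma moveProb_two_add_le (k : Colour) :
    moveProb (binaryOffspring p q) .P1 k 2 + (broodLaw p q k .br).toReal +
      moveProb (binaryOffspring p q) .P2 k 2 ≤ 1 := by
  have h := sum_broodLaw p q k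
  have h0 : 0 ≤ (broodLaw p q k .none).toReal := ENNReal.toReal_nonneg
  rw [moveProb_two, moveProb_two]
  cases k <;> simp only [target, Brood.pair] <;> linarith

lemma ae_not_stuck (hp : p .br = 1) (hq : q .br = 1) (j : Colour) :
    ∀ᵐ t ∂(gwFrom (binaryOffspring p q) j), ∀ a u, ¬ Stuck mono (j, t) a u := by
  have h : ∀ u : Vertex Colour, ∀ᵐ t ∂(gwFrom (binaryOffspring p q) j), ∀ k, t u k = 1 := fun u => by
    refine ae_all_iff.2 fun k => ?_
    have hm := (measurableSet_count k {1}).compl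
    have hz := gwFrom_eval (binaryOffspring p q) j u hm
    rw [(PMF.toMeasure_apply_eq_zero_iff _ hm).2] at hz
    · exact hz
    · have hbr : broodLaw p q (colour j u) .br = 1 := by cases colour j u <;> assumption
      rw [binaryOffspring_eq_map, PMF.support_map, (PMF.apply_eq_one_iff _ _).1 hbr]
      simp [Brood.count]
  -- There are countably many addresses, so almost surely all of them have one child of each colour.
  filter_upwards [ae_all_iff.2 h] with t ht a u
  rw [stuck_mono_iff, ht]
  exact one_ne_zero

lemma ae_forcedWin (h : ¬ (p .br = 1 ∧ q .br = 1)) (o : Player → Player) (i : Player)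
    (j : Colour) : ∀ᵐ t ∂(gwFrom (binaryOffspring p q) j),
      ∃ a n, ForcedWin mono (j, t) o a n i [] := by
  refine ae_exists_forcedWin (le_two_of_mem_support p q) (moveProb_one p q)
    (moveProb_two_add_le p q) ?_ o i j
  by_contra! hb
  exact h ⟨(ENNReal.toReal_eq_one_iff _).1 (hb .blue), (ENNReal.toReal_eq_one_iff _).1 (hb .red)⟩

end Offspring

end GWGame

theorem theorem2 (ρ : PMF GWGame.Colour) (p q : PMF GWGame.Brood) :
    ((p .br = 1 ∧ q .br = 1) → ∀ j : GWGame.Colour, ρ j ≠ 0 →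
      (∀ i : GWGame.Player, GWGame.drawProb ρ p q .normal i j = 1) ∧
      (∀ i : GWGame.Player, GWGame.drawProb ρ p q .misere i j = 1) ∧
      GWGame.stopperLossProb ρ p q j = 1) ∧
    (¬ (p .br = 1 ∧ q .br = 1) → ∀ j : GWGame.Colour, ρ j ≠ 0 →
      (∀ i : GWGame.Player, GWGame.drawProb ρ p q .normal i j = 0) ∧
      (∀ i : GWGame.Player, GWGame.drawProb ρ p q .misere i j = 0) ∧
      GWGame.stopperLossProb ρ p q j = 0) := by
  simp only [GWGame.drawProb, GWGame.stopperLossProb]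
  constructor
  · rintro ⟨hp, hq⟩ j hj
    simp only [GWGame.cond_gwTree _ j ρ hj]
    have hone : ∀ P : (GWGame.Vertex GWGame.Colour → GWGame.Colour → ℕ) → Prop,
        (∀ᵐ t ∂(GWGame.gwFrom (GWGame.binaryOffspring p q) j), P t) →
          GWGame.gwFrom (GWGame.binaryOffspring p q) j {t | P t} = 1 := fun P hP =>
      (measure_congr (Filter.eventuallyEq_univ.2 hP)).trans measure_univ
    have h := GWGame.ae_not_stuck p q hp hq j
    exact ⟨fun i => hone _ (h.mono fun t ht => GWGame.draw_of_not_stuck ht (by simp) i []),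
      fun i => hone _ (h.mono fun t ht => GWGame.draw_of_not_stuck ht (by simp) i []),
      hone _ (h.mono fun t ht => GWGame.loses_escape_of_not_stuck ht .P1 [])⟩
  · intro hpq j hj
    simp only [GWGame.cond_gwTree _ j ρ hj]
    have hzero : ∀ P : (GWGame.Vertex GWGame.Colour → GWGame.Colour → ℕ) → Prop,
        (∀ᵐ t ∂(GWGame.gwFrom (GWGame.binaryOffspring p q) j), ¬ P t) →
          GWGame.gwFrom (GWGame.binaryOffspring p q) j {t | P t} = 0 := fun P hP =>
      measure_eq_zero_iff_ae_notMem.2 hP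
    have h := fun o i => GWGame.ae_forcedWin p q hpq o i j
    refine ⟨fun i => hzero _ ?_, fun i => hzero _ ?_, hzero _ ?_⟩
    · filter_upwards [h GWGame.Game.normal.winner i] with t ⟨a, n, ht⟩
      exact GWGame.not_draw_of_forcedWin ht
    · filter_upwards [h GWGame.Game.misere.winner i] with t ⟨a, n, ht⟩
      exact GWGame.not_draw_of_forcedWin ht
    · filter_upwards [h GWGame.Game.escape.winner .P1] with t ⟨a, n, ht⟩
      exact GWGame.not_loses_escape_of_forcedWin ht
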